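/- For odd integers $p,q,r$ let $P(p,q,r)$ be the pretzel knot with three columns of $|p|,|q|,|r|$ crossings, the sign of each parameter giving the handedness of its column (so that $P(1,1,1)$ is the left-handed trefoil). The Alexander module of a knot $K$ is $H_1(X_\infty)$, where $X_\infty$ is the infinite cyclic cover of the complement of $K$; equivalently, it is the abelianization of the commutator subgroup of the knot group. It is a finitely presented $\mathbb{Z}[t,t^{-1}]$-module, where $t$ acts as the generating covering translation. If $A$ is a presentation matrix of it with $n$ generators, the $r$-th elementary ideal $E_r(K)\subseteq\mathbb{Z}[t,t^{-1}]$ is generated by the $(n-r+1)\times(n-r+1)$ minors of $A$ (with $E_0(K)=0$, and $E_r(K)=\mathbb{Z}[t,t^{-1}]$ for $r>n$). The Alexander polynomial of $K$ is a generator of the smallest principal ideal containing $E_1(K)$; it is defined up to multiplication by the units $\pm t^m$. **Theorem 4.1.** Let $s$ be a positive integer. 1. For every integer $i>s$, the Alexander polynomial of $P(-(2s+1),\,2s+1,\,2i+1)$ is, up to units, $$s(s+1)t^2-(2s(s+1)+1)t+s(s+1).$$ In particular, all these knots have the same Alexander polynomial. 2. For each positive integer $k$ put $i_{k,s}=(2k-1)s+k-1$.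 Then the knots $P(-(2s+1),\,2s+1,\,2i_{k,s}+1)$, $k\in\mathbb{Z}^+$, all have the same sequence of elementary ideals $(E_r)_{r\ge 0}$. -/

import Mathlib

open scoped LaurentPolynomial

noncomputable section

/-! ### Elementary ideals of a module -/

/-- The ideal generated by the `k × k` minors of `A` (the unit ideal for `k = 0`, the zero ideal
for `k` larger than the number of rows or columns).  The rows and columns are chosen by arbitrary
maps: repeated ones contribute `0`, and reordering only changes signs. -/
def minorIdeal {R : Type*} [CommRing R] {m n : ℕ} (A : Matrix (Fin m) (Fin n) R) (k : ℕ) :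
    Ideal R :=
  Ideal.span {d | ∃ (f : Fin k → Fin m) (g : Fin k → Fin n), d = (A.submatrix f g).det}

/-- `A` is a presentation matrix of `M`: the columns correspond to generators of `M`, and the rows
generate the module of relations between them. -/
def IsPresentationMatrix {R : Type*} [CommRing R] {m n : ℕ} (A : Matrix (Fin m) (Fin n) R)
    (M : Type*) [AddCommGroup M] [Module R M] : Prop :=
  ∃ π : (Fin n → R) →ₗ[R] M,
    Function.Surjective π ∧ LinearMap.ker π = Submodule.span R (Set.range fun i => A i)

/-- The `r`-th elementary ideal of a finitely presented module: for any presentation matrix with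
`n` generators, it is the ideal of the minors of size `n + 1 - r` (so it is the zero ideal for
`r = 0` and the unit ideal for `r > n`; the truncated subtraction is intended).  It does not depend
on the presentation, so that the supremum over all presentations is its common value. -/
def elementaryIdeal (R : Type*) [CommRing R] (M : Type*) [AddCommGroup M] [Module R M] (r : ℕ) :
    Ideal R :=
  ⨆ (m : ℕ) (n : ℕ) (A : Matrix (Fin m) (Fin n) R) (_ : IsPresentationMatrix A M),
    minorIdeal A (n + 1 - r)

/-! ### Oriented link diagrams and their groups -/

/-- The two strands at a crossing. -/
inductive Level : Type
  | over
  | under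

/-- The combinatorial data of a nonempty oriented link diagram (its signed Gauss code).  An edge
runs from one crossing to the next; at each crossing an over-strand and an under-strand come in and
go out, and every edge comes into exactly one crossing, and goes out of exactly one, on exactly one
level.  The embedding in the plane is not recorded, as the link group does not need it. -/
structure LinkDiagram where
  Crossing : Type
  Edge : Type
  incoming : Crossing → Level → Edge
  outgoing : Crossing → Level → Edge
  sign : Crossing → ℤˣ
  finite_crossing : Finite Crossing
  nonempty_crossing : Nonempty Crossing
  incoming_bijective : Function.Bijective fun x : Crossing × Level => incoming x.1 x.2
  outgoing_bijective : Function.Bijective fun x : Crossing × Level => outgoing x.1 x.2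

namespace LinkDiagram

variable (D : LinkDiagram)

/-- The Wirtinger relators.  The meridian does not change along the over-strand `o`; at a crossing
of sign `ε` the meridians `a`, `b` of the incoming and the outgoing under-strand satisfy
`b = o ^ (-ε) * a * o ^ ε`. -/
def wirtingerRelators : Set (FreeGroup D.Edge) :=
  {w | ∃ c : D.Crossing,
    w = FreeGroup.of (D.outgoing c .over) * (FreeGroup.of (D.incoming c .over))⁻¹ ∨
    w = FreeGroup.of (D.incoming c .over) ^ (D.sign c : ℤ) * FreeGroup.of (D.outgoing c .under) *
      (FreeGroup.of (D.incoming c .under) * FreeGroup.of (D.incoming c .over) ^ (D.sign c : ℤ))⁻¹}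

/-- The group of the link, that is, the fundamental group of its complement, by the Wirtinger
presentation. -/
abbrev LinkGroup : Type := PresentedGroup D.wirtingerRelators

/-- The meridian of an edge. -/
def meridian (e : D.Edge) : D.LinkGroup := PresentedGroup.of e

/-- The homomorphism from the link group to the infinite cyclic group that sends every meridian to
the generator (the total linking number with the link). For a knot it is the abelianization. -/
def linkingHom : D.LinkGroup →* Multiplicative ℤ :=
  PresentedGroup.toGroup (f := fun _ => Multiplicative.ofAdd 1) (by
    rintro w ⟨c, rfl | rfl⟩
    · simp
    · simp only [map_mul, map_inv, map_zpow, FreeGroup.lift_apply_of]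
      rw [mul_inv_eq_one, mul_comm])

/-- The underlying group of the Alexander module: the first homology group of the infinite cyclic
cover of the link complement, that is, the abelianization of the kernel of `linkingHom` (for a knot,
of the commutator subgroup of the knot group). -/
def AlexanderModule : Type := Additive (Abelianization D.linkingHom.ker)

instance : AddCommGroup D.AlexanderModule :=
  inferInstanceAs (AddCommGroup (Additive (Abelianization D.linkingHom.ker)))

/-- The automorphism of the Alexander module induced by the conjugation `x ↦ g * x * g⁻¹`. -/
def conjAlexander (g : D.LinkGroup) : D.AlexanderModule ≃+ D.AlexanderModule :=
  MulEquiv.toAdditive (MulEquiv.abelianizationCongr (MulAut.conjNormal g))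

/-- An edge of the diagram. -/
def baseEdge : D.Edge := D.incoming D.nonempty_crossing.some .over

/-- The generating covering translation: the conjugation by a meridian.  It does not depend on the
meridian, as elements of the kernel of `linkingHom` act trivially. -/
def deckTransformation : (Module.End ℤ D.AlexanderModule)ˣ :=
  (LinearMap.GeneralLinearGroup.generalLinearEquiv ℤ D.AlexanderModule).symm
    (D.conjAlexander (D.meridian D.baseEdge)).toIntLinearEquiv

/-- The Alexander module is a module over `ℤ[t, t⁻¹]`, where `t` acts as the generating covering
translation. -/
instance : Module ℤ[T;T⁻¹] D.AlexanderModule :=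
  Module.compHom D.AlexanderModule
    (AddMonoidAlgebra.lift ℤ (Module.End ℤ D.AlexanderModule) ℤ
      ((Units.coeHom _).comp (zpowersHom _ D.deckTransformation))).toRingHom

/-- The `r`-th elementary ideal of the link: that of its Alexander module. -/
def elementaryIdeal (r : ℕ) : Ideal ℤ[T;T⁻¹] :=
  _root_.elementaryIdeal ℤ[T;T⁻¹] D.AlexanderModule r

/-- `f` is the Alexander polynomial of the link (which is defined up to multiplication by the units
`±t ^ n`): it generates the smallest principal ideal that contains the first elementary ideal. -/
def IsAlexanderPolynomial (f : ℤ[T;T⁻¹]) : Prop :=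
  IsLeast {I : Ideal ℤ[T;T⁻¹] | I.IsPrincipal ∧ D.elementaryIdeal 1 ≤ I} (Ideal.span {f})

end LinkDiagram

/-! ### Pretzel knots with three odd columns -/

namespace Pretzel

/-- The crossings: those of column `j`, stacked from top to bottom. Crossing `h` of a column lies
between the heights `h` and `h + 1` (heights increase downwards). -/
abbrev Crossing (p : Fin 3 → ℤ) : Type := Σ j : Fin 3, Fin (p j).natAbs

/-- The edges: the arcs at the top (the `j`-th one joins the right end of column `j` to the left end
of the next column, cyclically), those at the bottom, and in column `j` the edges at the heights
`h + 1` for `h < |p j| - 1`, one on each side. -/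
abbrev Edge (p : Fin 3 → ℤ) : Type :=
  Fin 3 ⊕ Fin 3 ⊕ Σ j : Fin 3, Fin ((p j).natAbs - 1) × Bool

/-- The edge that passes through column `j` at height `h ≤ |p j|`, on the left (`false`) or on the
right (`true`). -/
def edgeAt (p : Fin 3 → ℤ) (j : Fin 3) (h : ℕ) (side : Bool) : Edge p :=
  if h = 0 then .inl (if side then j else j - 1)
  else if hh : h - 1 < (p j).natAbs - 1 then .inr (.inr ⟨j, ⟨h - 1, hh⟩, side⟩)
  else .inr (.inl (if side then j else j - 1))

/-- Of the two strands at a crossing, one runs downwards and one runs upwards (the two strands of an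
odd column of a pretzel knot with three odd columns are antiparallel); at each height `h` the
downward strand is on the left if `h` is even and on the right if `h` is odd.
In a column with `p j > 0` the strand with the ends north-east and south-west is the over-strand at
each crossing, in a column with `p j < 0` it is the other one.
This is `true` if the strand on the given level runs downwards. -/
def isDown (p : Fin 3 → ℤ) (c : Crossing p) : Level → Bool
  | .over => decide (0 < p c.1) == c.2.val.bodd
  | .under => !(decide (0 < p c.1) == c.2.val.bodd)

def incoming (p : Fin 3 → ℤ) (c : Crossing p) (l : Level) : Edge p :=
  if isDown p c l then edgeAt p c.1 c.2 (c.2 : ℕ).bodd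
  else edgeAt p c.1 (c.2 + 1) (c.2 : ℕ).bodd

def outgoing (p : Fin 3 → ℤ) (c : Crossing p) (l : Level) : Edge p :=
  if isDown p c l then edgeAt p c.1 (c.2 + 1) (!(c.2 : ℕ).bodd)
  else edgeAt p c.1 c.2 (!(c.2 : ℕ).bodd)

theorem exists_level (p : Fin 3 → ℤ) (c : Crossing p) (b : Bool) : ∃ l, isDown p c l = b := by
  by_cases h : isDown p c .over = b
  · exact ⟨_, h⟩
  · refine ⟨.under, ?_⟩
    have : isDown p c .under = !isDown p c .over := rfl
    rw [this]
    cases b <;> simpa using h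

theorem bijective_of_surjective (p : Fin 3 → ℤ) (hp : ∀ j, Odd (p j))
    (f : Crossing p × Level → Edge p) (hf : Function.Surjective f) : Function.Bijective f := by
  let e : Level ≃ Bool :=
    ⟨fun l => match l with | .over => true | .under => false,
      fun b => if b then .over else .under, by rintro (_ | _) <;> rfl, by rintro (_ | _) <;> rfl⟩
  have key : Function.Bijective (f ∘ ((Equiv.refl (Crossing p)).prodCongr e.symm)) := by
    rw [Fintype.bijective_iff_surjective_and_card]
    refine ⟨hf.comp (Equiv.surjective _), ?_⟩
    have h0 : ∀ j, (p j).natAbs ≠ 0 := fun j h => by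
      have := hp j; rw [Int.natAbs_eq_zero.mp h] at this; simp at this
    have := h0 0
    have := h0 1
    have := h0 2
    simp only [Fintype.card_prod, Fintype.card_sum, Fintype.card_sigma, Fintype.card_fin,
      Fintype.card_bool, Fin.sum_univ_three]
    omega
  exact (Equiv.bijective_comp _ f).mp key

theorem incoming_bijective (p : Fin 3 → ℤ) (hp : ∀ j, Odd (p j)) :
    Function.Bijective fun x : Crossing p × Level => incoming p x.1 x.2 := by
  have hodd : ∀ j, ∃ k, (p j).natAbs = 2 * k + 1 := fun j => (Int.natAbs_odd.mpr (hp j))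
  refine bijective_of_surjective p hp _ ?_
  rintro (j | j | ⟨j, h, side⟩)
  · obtain ⟨k, hk⟩ := hodd (j + 1)
    let c : Crossing p := ⟨j + 1, ⟨0, by omega⟩⟩
    obtain ⟨l, hl⟩ := exists_level p c true
    exact ⟨(c, l), by simp [incoming, hl, edgeAt, c]⟩
  · obtain ⟨k, hk⟩ := hodd (j + 1)
    let c : Crossing p := ⟨j + 1, ⟨2 * k, by omega⟩⟩
    obtain ⟨l, hl⟩ := exists_level p c false
    exact ⟨(c, l), by simp [incoming, hl, edgeAt, c, hk]⟩
  · by_cases hs : side = (h.val + 1).bodd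
    · let c : Crossing p := ⟨j, ⟨h + 1, by omega⟩⟩
      obtain ⟨l, hl⟩ := exists_level p c true
      exact ⟨(c, l), by simp [incoming, hl, edgeAt, c, hs]⟩
    · let c : Crossing p := ⟨j, ⟨h, by omega⟩⟩
      obtain ⟨l, hl⟩ := exists_level p c false
      refine ⟨(c, l), ?_⟩
      have hs' : side = h.val.bodd := by
        cases side <;> simp at hs ⊢ <;> simp [hs]
      simp [incoming, hl, edgeAt, c, hs']

theorem outgoing_bijective (p : Fin 3 → ℤ) (hp : ∀ j, Odd (p j)) :
    Function.Bijective fun x : Crossing p × Level => outgoing p x.1 x.2 := by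
  have hodd : ∀ j, ∃ k, (p j).natAbs = 2 * k + 1 := fun j => (Int.natAbs_odd.mpr (hp j))
  refine bijective_of_surjective p hp _ ?_
  rintro (j | j | ⟨j, h, side⟩)
  · obtain ⟨k, hk⟩ := hodd j
    let c : Crossing p := ⟨j, ⟨0, by omega⟩⟩
    obtain ⟨l, hl⟩ := exists_level p c false
    exact ⟨(c, l), by simp [outgoing, hl, edgeAt, c]⟩
  · obtain ⟨k, hk⟩ := hodd j
    let c : Crossing p := ⟨j, ⟨2 * k, by omega⟩⟩
    obtain ⟨l, hl⟩ := exists_level p c true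
    exact ⟨(c, l), by simp [outgoing, hl, edgeAt, c, hk]⟩
  · by_cases hs : side = (h.val + 1).bodd
    · let c : Crossing p := ⟨j, ⟨h, by omega⟩⟩
      obtain ⟨l, hl⟩ := exists_level p c true
      exact ⟨(c, l), by simp [outgoing, hl, edgeAt, c, hs]⟩
    · let c : Crossing p := ⟨j, ⟨h + 1, by omega⟩⟩
      obtain ⟨l, hl⟩ := exists_level p c false
      refine ⟨(c, l), ?_⟩
      have hs' : side = h.val.bodd := by
        cases side <;> simp at hs ⊢ <;> simp [hs]
      simp [outgoing, hl, edgeAt, c, hs']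

end Pretzel

/-- The standard diagram of the pretzel knot `P(p 0, p 1, p 2)` with three odd parameters: three
vertical columns of `|p j|` crossings between two strands, the columns being joined cyclically at
the top and at the bottom.  As the two strands of a column are antiparallel, the crossings of a
column with `p j > 0` are negative: `P(1, 1, 1)` is the left-handed trefoil knot. -/
def pretzelKnot (p : Fin 3 → ℤ) (hp : ∀ j, Odd (p j)) : LinkDiagram where
  Crossing := Pretzel.Crossing p
  Edge := Pretzel.Edge p
  incoming := Pretzel.incoming p
  outgoing := Pretzel.outgoing p
  sign c := if 0 < p c.1 then -1 else 1
  finite_crossing := inferInstance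
  nonempty_crossing :=
    ⟨⟨0, ⟨0, Nat.pos_of_ne_zero fun h => by
      have := hp 0; rw [Int.natAbs_eq_zero.mp h] at this; simp at this⟩⟩⟩
  incoming_bijective := Pretzel.incoming_bijective p hp
  outgoing_bijective := Pretzel.outgoing_bijective p hp

/-- The pretzel knot `P(-(2s+1), 2s+1, 2i+1)`. -/
def pretzelFamily (s i : ℤ) : LinkDiagram :=
  pretzelKnot ![-(2 * s + 1), 2 * s + 1, 2 * i + 1] (by
    intro j
    fin_cases j
    · exact (odd_two_mul_add_one s).neg
    · exact odd_two_mul_add_one s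
    · exact odd_two_mul_add_one i)

end

/-! Everything reduces to a 2 × 2 presentation matrix. Colour the edges of a diagram by elements of
a `ℤ[t, t⁻¹]`-module subject to the abelianized Wirtinger relations. A colouring makes the link
group act by affine maps `x ↦ t x + a`, and the Alexander module carries the universal colouring
that vanishes on the base edge (`IsColoring.exists_linearMap`). In a pretzel diagram the two colours
at the top of a column determine all the others in it. Matching the bottom arcs leaves three
relations with sum zero between the top arcs, hence two relations between two differences
(`isPresentationMatrix_alexanderMatrix`).

Minor ideals do not depend on the presentation (`elementaryIdeal_eq_minorIdeal`): they equal
`relationDetIdeal`, which involves only a family of generators, and two generating families are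
compared through their concatenation.

For the family, the matrix has rows `(0, α)` and `(β, γ)` with `α = s t - (s + 1)`, `β = s - (s + 1)
t`, `γ = -(1 + i - i t)`. So `E₁` is generated by `-αβ`, which does not involve `i`. Since `α + β =
-(t + 1)`, the ideal `(α, β)` is `(2s + 1, t + 1)`. Modulo `t + 1`, `γ` becomes `-(2i + 1)`, and for
`i = (2k - 1)s + k - 1` one has `2i + 1 = (2k - 1)(2s + 1)`. Thus `γ` is redundant and `E₂ = (2s +
1, t + 1)` for every `k`. The other ideals are zero or the unit ideal. -/

noncomputable section

/-! ### Invariance of the elementary ideals -/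

section FittingInvariance

variable {R : Type*} [CommRing R] {M : Type*} [AddCommGroup M] [Module R M]

/-- The ideal generated by the determinants of the square matrices, all but at most `j` of whose
rows are relations between the members of the family `v`. -/
def relationDetIdeal {ι : Type*} [Fintype ι] [DecidableEq ι] (v : ι → M) (j : ℕ) : Ideal R :=
  Ideal.span {d | ∃ (X : Matrix ι ι R) (S : Finset ι), Fintype.card ι ≤ S.card + j ∧
    (∀ i ∈ S, ∑ k, X i k • v k = 0) ∧ d = X.det}

theorem det_mem_relationDetIdeal {ι : Type*} [Fintype ι] [DecidableEq ι] {v : ι → M} {j : ℕ}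
    (X : Matrix ι ι R) (S : Finset ι) (hS : Fintype.card ι ≤ S.card + j)
    (h : ∀ i ∈ S, ∑ k, X i k • v k = 0) : X.det ∈ relationDetIdeal v j :=
  Ideal.subset_span ⟨X, S, hS, h, rfl⟩

theorem relationDetIdeal_comp_equiv_le {ι κ : Type*} [Fintype ι] [DecidableEq ι] [Fintype κ]
    [DecidableEq κ] (e : ι ≃ κ) (v : κ → M) (j : ℕ) :
    relationDetIdeal (R := R) (v ∘ e) j ≤ relationDetIdeal v j := by
  refine Ideal.span_le.mpr ?_
  rintro _ ⟨X, S, hS, h, rfl⟩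
  rw [← Matrix.det_reindex_self e X]
  refine det_mem_relationDetIdeal _ (S.map e.toEmbedding) ?_ ?_
  · rwa [Finset.card_map, ← Fintype.card_congr e]
  · intro i hi
    obtain ⟨a, ha, rfl⟩ := Finset.mem_map.mp hi
    rw [← h a ha, ← Equiv.sum_comp e]
    simp

theorem relationDetIdeal_comp_equiv {ι κ : Type*} [Fintype ι] [DecidableEq ι] [Fintype κ]
    [DecidableEq κ] (e : ι ≃ κ) (v : κ → M) (j : ℕ) :
    relationDetIdeal (R := R) (v ∘ e) j = relationDetIdeal v j := by
  refine le_antisymm (relationDetIdeal_comp_equiv_le e v j) ?_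
  have := relationDetIdeal_comp_equiv_le (R := R) e.symm (v ∘ e) j
  rwa [Function.comp_assoc, Equiv.self_comp_symm, Function.comp_id] at this

theorem card_le_card_preimage_succAbove {n : ℕ} (S : Finset (Fin (n + 1))) (i : Fin (n + 1)) :
    S.card ≤ (Finset.univ.filter fun a => i.succAbove a ∈ S).card + 1 := by
  have : S ⊆ insert i ((Finset.univ.filter fun a => i.succAbove a ∈ S).map i.succAboveEmb) := by
    intro x hx
    rcases Fin.eq_self_or_eq_succAbove i x with rfl | ⟨y, rfl⟩
    · simp
    · simp [hx]
  exact (Finset.card_le_card this).trans ((Finset.card_insert_le _ _).trans (by simp))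

theorem card_erase_le_card_preimage_succAbove {n : ℕ} (S : Finset (Fin (n + 1)))
    (i : Fin (n + 1)) :
    (S.erase i).card ≤ (Finset.univ.filter fun a => i.succAbove a ∈ S).card := by
  have : S.erase i ⊆ (Finset.univ.filter fun a => i.succAbove a ∈ S).map i.succAboveEmb := by
    intro x hx
    rw [Finset.mem_erase] at hx
    obtain ⟨y, rfl⟩ := Fin.exists_succAbove_eq hx.1
    simp [hx.2]
  exact (Finset.card_le_card this).trans (by simp)

/-- A redundant generator can be eliminated by a column operation. Laplace expansion along its
column then lowers the size by one and loses at most one relation row, so the bound `j` survives.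
Conversely, a matrix can be bordered by the relation that expresses the redundant generator. -/
theorem relationDetIdeal_cons {n : ℕ} (v : Fin n → M) (c : Fin n → R) (j : ℕ) :
    relationDetIdeal (R := R) (Fin.cons (∑ k, c k • v k) v : Fin (n + 1) → M) j =
      relationDetIdeal v j := by
  apply le_antisymm
  · refine Ideal.span_le.mpr ?_
    rintro _ ⟨X, S, hS, h, rfl⟩
    -- Right multiplication by this unipotent matrix adds `c k` times column `0` to column `k + 1`,
    -- that is, it substitutes the expression for the redundant generator.
    let P : Matrix (Fin (n + 1)) (Fin (n + 1)) R :=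
      Matrix.of (Fin.cons (Fin.cons 1 c) fun i => Fin.cons 0 ((1 : Matrix (Fin n) (Fin n) R) i))
    have hP : P.det = 1 := by
      rw [Matrix.det_succ_column_zero, Fin.sum_univ_succ]
      have : P.submatrix (Fin.succAbove 0) Fin.succ = 1 := by
        ext a b; simp [P]
      rw [this]
      simp [P]
    have hX : X.det = (X * P).det := by rw [Matrix.det_mul, hP, mul_one]
    have hXP : ∀ i k, (X * P) i (Fin.succ k) = X i 0 * c k + X i k.succ := by
      intro i k
      simp [Matrix.mul_apply, Fin.sum_univ_succ, P, Matrix.one_apply]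
    rw [SetLike.mem_coe, hX, Matrix.det_succ_column_zero]
    refine Ideal.sum_mem _ fun i _ => Ideal.mul_mem_left _ _ ?_
    refine det_mem_relationDetIdeal _ (Finset.univ.filter fun a => i.succAbove a ∈ S) ?_ ?_
    · have := card_le_card_preimage_succAbove S i
      simp only [Fintype.card_fin] at hS ⊢
      omega
    · intro a ha
      have := h _ (Finset.mem_filter.mp ha).2
      rw [Fin.sum_univ_succ] at this
      simp only [Fin.cons_zero, Fin.cons_succ, Finset.smul_sum, smul_smul] at this
      simp only [Matrix.submatrix_apply, hXP, add_smul, Finset.sum_add_distrib]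
      exact this
  · refine Ideal.span_le.mpr ?_
    rintro _ ⟨X, S, hS, h, rfl⟩
    -- The new row `(1, -c)` is itself a relation, so the number of relation rows grows with the
    -- size.
    let Y : Matrix (Fin (n + 1)) (Fin (n + 1)) R :=
      Matrix.of (Fin.cons (Fin.cons 1 (-c)) fun i => Fin.cons 0 (X i))
    have hY : X.det = Y.det := by
      rw [Matrix.det_succ_column_zero, Fin.sum_univ_succ]
      have : Y.submatrix (Fin.succAbove 0) Fin.succ = X := by
        ext a b; simp [Y]
      rw [this]
      simp [Y]
    rw [SetLike.mem_coe, hY]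
    refine det_mem_relationDetIdeal _ (insert 0 (S.map (Fin.succEmb n))) ?_ ?_
    · rw [Finset.card_insert_of_notMem (by simp [Fin.succ_ne_zero]), Finset.card_map]
      simp only [Fintype.card_fin] at hS ⊢
      omega
    · intro i hi
      rw [Finset.mem_insert] at hi
      rcases hi with rfl | hi
      · simp [Fin.sum_univ_succ, Y]
      · obtain ⟨a, ha, rfl⟩ := Finset.mem_map.mp hi
        simpa [Fin.sum_univ_succ, Y] using h a ha

theorem relationDetIdeal_option {ι : Type*} [Fintype ι] [DecidableEq ι] (v : Option ι → M)
    (hv : v none ∈ Submodule.span R (Set.range (v ∘ some))) (j : ℕ) :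
    relationDetIdeal (R := R) v j = relationDetIdeal (v ∘ some) j := by
  obtain ⟨c, hc⟩ := (Submodule.mem_span_range_iff_exists_fun R).mp hv
  let e : Fin (Fintype.card ι) ≃ ι := (Fintype.equivFin ι).symm
  rw [← relationDetIdeal_comp_equiv ((finSuccEquiv _).trans (Equiv.optionCongr e)) v,
    ← relationDetIdeal_comp_equiv e (v ∘ some), ← relationDetIdeal_cons _ (c ∘ e)]
  congr 1
  funext i
  refine Fin.cases ?_ (fun i => ?_) i
  · simp only [Function.comp_apply, Fin.cons_zero]
    rw [Equiv.sum_comp e fun k => c k • v (some k)]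
    simpa using hc.symm
  · simp

theorem relationDetIdeal_sumElim {ι : Type*} [Fintype ι] [DecidableEq ι] (v : ι → M)
    (hv : Submodule.span R (Set.range v) = ⊤) {m : ℕ} (w : Fin m → M) (j : ℕ) :
    relationDetIdeal (R := R) (Sum.elim w v) j = relationDetIdeal v j := by
  induction m with
  | zero =>
    rw [← relationDetIdeal_comp_equiv (Equiv.emptySum (Fin 0) ι).symm (Sum.elim w v)]
    rfl
  | succ m ih =>
    let e : Option (Fin m ⊕ ι) ≃ Fin (m + 1) ⊕ ι :=
      { toFun := fun o => o.elim (Sum.inl 0) (Sum.map Fin.succ id)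
        invFun := Sum.elim (Fin.cases none fun i => some (Sum.inl i)) fun i => some (Sum.inr i)
        left_inv := by rintro (_ | _ | _) <;> rfl
        right_inv := by
          rintro (i | _)
          · refine Fin.cases rfl (fun _ => rfl) i
          · rfl }
    rw [← relationDetIdeal_comp_equiv e, ← ih (w ∘ Fin.succ), relationDetIdeal_option]
    · congr 1
      funext x
      rcases x with _ | _ <;> rfl
    · refine Submodule.span_mono ?_ (hv ▸ Submodule.mem_top)
      rintro _ ⟨i, rfl⟩
      exact ⟨Sum.inr i, rfl⟩

theorem relationDetIdeal_eq {m n : ℕ} (v : Fin n → M) (w : Fin m → M)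
    (hv : Submodule.span R (Set.range v) = ⊤) (hw : Submodule.span R (Set.range w) = ⊤) (j : ℕ) :
    relationDetIdeal (R := R) v j = relationDetIdeal w j := by
  rw [← relationDetIdeal_sumElim v hv w, ← relationDetIdeal_sumElim w hw v,
    ← relationDetIdeal_comp_equiv (Equiv.sumComm (Fin n) (Fin m)) (Sum.elim w v)]
  congr 1
  funext x
  rcases x with _ | _ <;> rfl

/-- Laplace expansion removes surplus rows, those outside `S` first, until exactly `k` rows remain,
all in the row span; multilinearity in the rows then gives a combination of `k × k` minors. The
column map `g` is there so that the induction can delete columns. -/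
theorem det_mem_minorIdeal_of_rows_mem_span {m n : ℕ} (A : Matrix (Fin m) (Fin n) R) (k l : ℕ)
    (X : Matrix (Fin l) (Fin l) R) (S : Finset (Fin l)) (hS : k ≤ S.card) (g : Fin l → Fin n)
    (h : ∀ i ∈ S, ∃ y ∈ Submodule.span R (Set.range fun i => A i), X i = y ∘ g) :
    X.det ∈ minorIdeal A k := by
  induction l with
  | zero =>
    obtain rfl : k = 0 := by simpa [Finset.eq_empty_of_isEmpty S] using hS
    exact Ideal.subset_span ⟨Fin.elim0, g, by simp⟩
  | succ l ih =>
    have hSl : S.card ≤ l + 1 := by simpa using S.card_le_univ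
    obtain rfl | hlt := (hS.trans hSl).eq_or_lt
    · obtain rfl : S = Finset.univ := (Finset.card_eq_iff_eq_univ S).mp (by simp; omega)
      choose y hy hX using fun i => h i (Finset.mem_univ i)
      choose c hc using fun i => (Submodule.mem_span_range_iff_exists_fun R).mp (hy i)
      have : X = fun i => ∑ a, c i a • (fun b => A a (g b)) := by
        funext i
        rw [hX i, ← hc i]
        funext b
        simp
      rw [this]
      change Matrix.detRowAlternating.toMultilinearMap _ ∈ _
      rw [MultilinearMap.map_sum]
      refine Ideal.sum_mem _ fun f _ => ?_
      rw [MultilinearMap.map_smul_univ, smul_eq_mul]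
      exact Ideal.mul_mem_left _ _ (Ideal.subset_span ⟨f, g, rfl⟩)
    · obtain ⟨i, hi⟩ : ∃ i, k ≤ (S.erase i).card := by
        by_cases hu : S = Finset.univ
        · refine ⟨0, ?_⟩
          rw [hu, Finset.card_erase_of_mem (Finset.mem_univ _)]
          simp
          omega
        · obtain ⟨i, hi⟩ : ∃ i, i ∉ S := by
            by_contra! hh
            exact hu (Finset.eq_univ_of_forall hh)
          exact ⟨i, by rwa [Finset.erase_eq_of_notMem hi]⟩
      rw [Matrix.det_succ_row X i]
      refine Ideal.sum_mem _ fun b _ => Ideal.mul_mem_left _ _ ?_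
      refine ih _ (Finset.univ.filter fun a => i.succAbove a ∈ S)
        (hi.trans (card_erase_le_card_preimage_succAbove S i)) (g ∘ b.succAbove) fun a ha => ?_
      obtain ⟨y, hy, hX⟩ := h _ (Finset.mem_filter.mp ha).2
      refine ⟨y, hy, ?_⟩
      funext x
      exact congrFun hX _

theorem sum_smul_map_single {n : ℕ} (π : (Fin n → R) →ₗ[R] M) (x : Fin n → R) :
    ∑ k, x k • π (Pi.single k 1) = π x := by
  rw [LinearMap.pi_apply_eq_sum_univ π x]
  refine Finset.sum_congr rfl fun k _ => ?_
  congr 2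
  funext a
  simp [Pi.single_apply, eq_comm]

theorem minorIdeal_eq_relationDetIdeal {m n : ℕ} {A : Matrix (Fin m) (Fin n) R}
    {π : (Fin n → R) →ₗ[R] M}
    (hπ : LinearMap.ker π = Submodule.span R (Set.range fun i => A i)) (j : ℕ) :
    minorIdeal A (n - j) = relationDetIdeal (R := R) (fun k => π (Pi.single k 1)) j := by
  have hsum := sum_smul_map_single π
  apply le_antisymm
  · refine Ideal.span_le.mpr ?_
    rintro _ ⟨f, g, rfl⟩
    by_cases hg : Function.Injective g
    · classical
      -- The minor is completed to an `n × n` determinant of the same value by an identity block on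
      -- the unused columns; the rows coming from `A` are relations.
      let e : Fin (n - j) ⊕ ((Set.range g)ᶜ : Set (Fin n)) ≃ Fin n :=
        ((Equiv.ofInjective g hg).sumCongr (Equiv.refl _)).trans (Equiv.Set.sumCompl _)
      have he : ∀ a, e (Sum.inl a) = g a := fun a => rfl
      rw [SetLike.mem_coe, ← relationDetIdeal_comp_equiv e]
      let X := Matrix.fromBlocks (A.submatrix f g) (A.submatrix f fun x => e (Sum.inr x))
        (0 : Matrix ((Set.range g)ᶜ : Set (Fin n)) (Fin (n - j)) R) 1
      have hX : (A.submatrix f g).det = X.det := by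
        rw [Matrix.det_fromBlocks_zero₂₁, Matrix.det_one, mul_one]
      rw [hX]
      refine det_mem_relationDetIdeal X (Finset.univ.map Function.Embedding.inl) ?_ ?_
      · rw [Fintype.card_congr e]
        simp
        omega
      · intro i hi
        obtain ⟨a, -, rfl⟩ := Finset.mem_map.mp hi
        have : ∀ x, X (Sum.inl a) x = A (f a) (e x) := by
          rintro (x | x) <;> rfl
        simp only [Function.Embedding.inl_apply, this, Function.comp_apply]
        rw [Equiv.sum_comp e fun x => A (f a) x • π (Pi.single x 1), hsum, ← LinearMap.mem_ker, hπ]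
        exact Submodule.subset_span ⟨f a, rfl⟩
    · simp only [Function.Injective, not_forall] at hg
      obtain ⟨a, b, hab, hne⟩ := hg
      rw [SetLike.mem_coe, Matrix.det_zero_of_column_eq hne (fun i => by simp [hab])]
      exact zero_mem _
  · refine Ideal.span_le.mpr ?_
    rintro _ ⟨X, S, hS, h, rfl⟩
    refine det_mem_minorIdeal_of_rows_mem_span A _ n X S ?_ id fun i hi => ⟨X i, ?_, rfl⟩
    · simp only [Fintype.card_fin] at hS
      omega
    · rw [← hπ, LinearMap.mem_ker, ← hsum]
      exact h i hi

theorem minorIdeal_eq_bot {m n k : ℕ} (A : Matrix (Fin m) (Fin n) R) (hk : n < k) :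
    minorIdeal A k = ⊥ := by
  refine eq_bot_iff.mpr (Ideal.span_le.mpr ?_)
  rintro _ ⟨f, g, rfl⟩
  obtain ⟨a, b, hne, hab⟩ := Fintype.exists_ne_map_eq_of_card_lt g (by simpa)
  exact Matrix.det_zero_of_column_eq hne fun i => by simp [hab]

theorem minorIdeal_self {n : ℕ} (A : Matrix (Fin n) (Fin n) R) :
    minorIdeal A n = Ideal.span {A.det} := by
  apply le_antisymm
  · refine Ideal.span_le.mpr ?_
    rintro _ ⟨f, g, rfl⟩
    have : A.submatrix f g = (1 : Matrix (Fin n) (Fin n) R).submatrix f id * A *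
        (1 : Matrix (Fin n) (Fin n) R).submatrix id g := by
      ext i j
      simp [Matrix.mul_apply, Matrix.one_apply]
    rw [this, Matrix.det_mul, Matrix.det_mul, SetLike.mem_coe, Ideal.mem_span_singleton]
    exact (Dvd.intro_left _ rfl).mul_right _
  · rw [Ideal.span_singleton_le_iff_mem]
    exact Ideal.subset_span ⟨id, id, by simp⟩

theorem apply_mem_minorIdeal_one {m n : ℕ} (A : Matrix (Fin m) (Fin n) R)
    (i : Fin m) (j : Fin n) : A i j ∈ minorIdeal A 1 :=
  Ideal.subset_span ⟨fun _ => i, fun _ => j, by simp⟩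

theorem minorIdeal_one_le {m n : ℕ} {A : Matrix (Fin m) (Fin n) R}
    {I : Ideal R} (h : ∀ i j, A i j ∈ I) : minorIdeal A 1 ≤ I := by
  refine Ideal.span_le.mpr ?_
  rintro _ ⟨f, g, rfl⟩
  simpa using h _ _

theorem minorIdeal_zero {m n : ℕ} (A : Matrix (Fin m) (Fin n) R) :
    minorIdeal A 0 = ⊤ :=
  Ideal.eq_top_of_isUnit_mem _ (Ideal.subset_span ⟨Fin.elim0, Fin.elim0, rfl⟩) (by simp)

theorem span_range_map_single {n : ℕ} {π : (Fin n → R) →ₗ[R] M} (hπ : Function.Surjective π) :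
    Submodule.span R (Set.range fun k => π (Pi.single k 1)) = ⊤ := by
  refine eq_top_iff.mpr fun x _ => ?_
  obtain ⟨y, rfl⟩ := hπ x
  rw [← sum_smul_map_single π y]
  exact Submodule.sum_mem _ fun i _ => Submodule.smul_mem _ _ (Submodule.subset_span ⟨i, rfl⟩)

/-- The elementary ideals may be computed from any presentation matrix. -/
theorem elementaryIdeal_eq_minorIdeal {m n : ℕ} {A : Matrix (Fin m) (Fin n) R}
    (hA : IsPresentationMatrix A M) (r : ℕ) :
    elementaryIdeal R M r = minorIdeal A (n + 1 - r) := by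
  refine le_antisymm ?_ (le_iSup₂_of_le m n (le_iSup₂_of_le A hA le_rfl))
  refine iSup₂_le fun m' n' => iSup₂_le fun B hB => ?_
  -- For `r = 0` the minors are larger than the number of columns, so they generate zero; only `r =
  -- j + 1` is covered by `relationDetIdeal`.
  rcases r with _ | j
  · rw [minorIdeal_eq_bot B (by omega)]
    exact bot_le
  · obtain ⟨π, hπ, hker⟩ := hA
    obtain ⟨ρ, hρ, hker'⟩ := hB
    rw [Nat.add_sub_add_right, Nat.add_sub_add_right, minorIdeal_eq_relationDetIdeal hker,
      minorIdeal_eq_relationDetIdeal hker',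
      relationDetIdeal_eq _ _ (span_range_map_single hπ) (span_range_map_single hρ)]

end FittingInvariance

/-! ### The universal property of the Alexander module -/

namespace LinkDiagram

open LaurentPolynomial

theorem T_one_smul_T_neg_one_smul {N : Type*} [AddCommGroup N] [Module ℤ[T;T⁻¹] N] (x : N) :
    (T 1 : ℤ[T;T⁻¹]) • (T (-1) : ℤ[T;T⁻¹]) • x = x := by
  rw [smul_smul, ← T_add]
  simp

theorem T_neg_one_smul_T_one_smul {N : Type*} [AddCommGroup N] [Module ℤ[T;T⁻¹] N] (x : N) :
    (T (-1) : ℤ[T;T⁻¹]) • (T 1 : ℤ[T;T⁻¹]) • x = x := by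
  rw [smul_smul, ← T_add]
  simp

/-- An additive map that commutes with the action of `t` is linear over `ℤ[t, t⁻¹]`. -/
def laurentLinearMap {M N : Type*} [AddCommGroup M] [Module ℤ[T;T⁻¹] M] [AddCommGroup N]
    [Module ℤ[T;T⁻¹] N] (f : M →+ N)
    (hf : ∀ x, f ((T 1 : ℤ[T;T⁻¹]) • x) = (T 1 : ℤ[T;T⁻¹]) • f x) : M →ₗ[ℤ[T;T⁻¹]] N where
  __ := f
  map_smul' := by
    have hT : ∀ (n : ℤ) (x : M), f ((T n : ℤ[T;T⁻¹]) • x) = (T n : ℤ[T;T⁻¹]) • f x := by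
      intro n
      induction n with
      | zero => simp
      | succ n ih =>
        intro x
        rw [add_comm, T_add, mul_smul, mul_smul, hf, ih]
      | pred n ih =>
        intro x
        rw [sub_eq_add_neg, add_comm, T_add, mul_smul, mul_smul, ← ih]
        conv_rhs => rw [← T_one_smul_T_neg_one_smul ((T (-(n : ℤ)) : ℤ[T;T⁻¹]) • x), hf,
          T_neg_one_smul_T_one_smul]
    intro p x
    change f (p • x) = p • f x
    induction p using LaurentPolynomial.induction_on' with
    | add p q hp hq => rw [add_smul, add_smul, map_add, hp, hq]
    | C_mul_T n a =>
      have hC : (C a : ℤ[T;T⁻¹]) = (a : ℤ[T;T⁻¹]) := by simp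
      rw [mul_smul, mul_smul, hC, Int.cast_smul_eq_zsmul, Int.cast_smul_eq_zsmul, map_zsmul, hT]

variable (D : LinkDiagram)

/-- A colouring of the edges by elements of a `ℤ[t, t⁻¹]`-module which satisfies the abelianized
Wirtinger relations (a colouring by an Alexander quandle). -/
structure IsColoring {N : Type*} [AddCommGroup N] [Module ℤ[T;T⁻¹] N] (c : D.Edge → N) : Prop where
  over_eq : ∀ x, c (D.outgoing x .over) = c (D.incoming x .over)
  under_pos : ∀ x, D.sign x = 1 →
    (T 1 : ℤ[T;T⁻¹]) • c (D.outgoing x .under) + c (D.incoming x .over) =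
      (T 1 : ℤ[T;T⁻¹]) • c (D.incoming x .over) + c (D.incoming x .under)
  under_neg : ∀ x, D.sign x = -1 →
    (T 1 : ℤ[T;T⁻¹]) • c (D.incoming x .over) + c (D.outgoing x .under) =
      (T 1 : ℤ[T;T⁻¹]) • c (D.incoming x .under) + c (D.incoming x .over)

variable {D}

/-! ### Affine actions of the link group defined by colourings -/

section ColoringHom

variable {N : Type*} [AddCommGroup N] [Module ℤ[T;T⁻¹] N]

/-- The affine permutation `x ↦ t x + a`. -/
def affinePerm (a : N) : Equiv.Perm N where
  toFun x := (T 1 : ℤ[T;T⁻¹]) • x + a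
  invFun x := (T (-1) : ℤ[T;T⁻¹]) • (x - a)
  left_inv x := by simp [T_neg_one_smul_T_one_smul]
  right_inv x := by simp [T_one_smul_T_neg_one_smul]

theorem affinePerm_apply (a x : N) : affinePerm a x = (T 1 : ℤ[T;T⁻¹]) • x + a := rfl

theorem affinePerm_mul_eq {a b c d : N}
    (h : (T 1 : ℤ[T;T⁻¹]) • b + a = (T 1 : ℤ[T;T⁻¹]) • d + c) :
    affinePerm a * affinePerm b = affinePerm c * affinePerm d := by
  ext x
  simp only [Equiv.Perm.mul_apply, affinePerm_apply, smul_add, add_assoc, h]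

variable {c : D.Edge → N}

/-- The action of the link group by affine permutations which is defined by a colouring. -/
def IsColoring.affineHom (hc : D.IsColoring c) : D.LinkGroup →* Equiv.Perm N :=
  PresentedGroup.toGroup (f := fun e => affinePerm (c e)) (by
    rintro w ⟨x, rfl | rfl⟩
    · simp [hc.over_eq]
    · simp only [map_mul, map_inv, map_zpow, FreeGroup.lift_apply_of]
      rw [mul_inv_eq_one]
      rcases Int.units_eq_one_or (D.sign x) with h | h
      · simpa [h] using affinePerm_mul_eq (hc.under_pos x h)
      · have := affinePerm_mul_eq (hc.under_neg x h)
        simp only [h, Units.val_neg, Units.val_one, zpow_neg, zpow_one]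
        rw [inv_mul_eq_iff_eq_mul, ← mul_assoc, eq_mul_inv_iff_mul_eq, this])

theorem IsColoring.affineHom_meridian (hc : D.IsColoring c) (e : D.Edge) :
    hc.affineHom (D.meridian e) = affinePerm (c e) :=
  PresentedGroup.toGroup.of _

theorem linkingHom_meridian (e : D.Edge) :
    D.linkingHom (D.meridian e) = Multiplicative.ofAdd 1 :=
  PresentedGroup.toGroup.of _

theorem closure_range_meridian : Subgroup.closure (Set.range D.meridian) = ⊤ :=
  PresentedGroup.closure_range_of _

/-- The linear part is multiplicative and equals `t` on every meridian. In particular the kernel of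
`linkingHom` acts by translations, which is what makes `kerHom` a homomorphism. -/
theorem IsColoring.affineHom_apply (hc : D.IsColoring c) (g : D.LinkGroup) (x : N) :
    hc.affineHom g x =
      (T (D.linkingHom g).toAdd : ℤ[T;T⁻¹]) • x + hc.affineHom g 0 := by
  have hg : g ∈ Subgroup.closure (Set.range D.meridian) := by
    rw [closure_range_meridian]; trivial
  induction hg using Subgroup.closure_induction generalizing x with
  | mem g hg =>
    obtain ⟨e, rfl⟩ := hg
    simp [hc.affineHom_meridian, linkingHom_meridian, affinePerm_apply]
  | one => simp
  | mul g h _ _ hg hh =>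
    rw [map_mul, Equiv.Perm.mul_apply, Equiv.Perm.mul_apply, hh x, hg, hg (hc.affineHom h 0),
      map_mul, toAdd_mul, T_add, smul_add, mul_smul, add_assoc]
  | inv g _ hg =>
    have h1 := hg (hc.affineHom g⁻¹ x)
    have h2 := hg (hc.affineHom g⁻¹ 0)
    rw [← Equiv.Perm.mul_apply, ← map_mul, mul_inv_cancel, map_one, Equiv.Perm.one_apply] at h1 h2
    have h3 : x = (T (D.linkingHom g).toAdd : ℤ[T;T⁻¹]) •
        (hc.affineHom g⁻¹ x - hc.affineHom g⁻¹ 0) := by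
      rw [smul_sub, eq_sub_of_add_eq h1.symm, eq_sub_of_add_eq h2.symm]
      abel
    rw [map_inv D.linkingHom, toAdd_inv]
    conv_rhs => rw [h3, smul_smul, ← T_add]
    simp

/-- The homomorphism on the kernel of `linkingHom` that is defined by a colouring. -/
def IsColoring.kerHom (hc : D.IsColoring c) : D.linkingHom.ker →* Multiplicative N where
  toFun g := Multiplicative.ofAdd (hc.affineHom g 0)
  map_one' := by simp
  map_mul' g h := by
    rw [← ofAdd_add, Subgroup.coe_mul, map_mul, Equiv.Perm.mul_apply, hc.affineHom_apply,
      MonoidHom.mem_ker.mp g.2, toAdd_one, T_zero, one_smul, add_comm]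

end ColoringHom

/-- The class of an element of the kernel of `linkingHom` in the Alexander module. -/
def alexanderClass (x : D.linkingHom.ker) : D.AlexanderModule :=
  Additive.ofMul (Abelianization.of x)

theorem alexanderClass_mul (x y : D.linkingHom.ker) :
    alexanderClass (x * y) = alexanderClass x + alexanderClass y := rfl

theorem alexanderClass_one : alexanderClass (1 : D.linkingHom.ker) = 0 := rfl

theorem alexanderClass_surjective : Function.Surjective (alexanderClass (D := D)) := fun x => by
  obtain ⟨y, hy⟩ := QuotientGroup.mk_surjective (Additive.toMul x)
  exact ⟨y, hy⟩

theorem T_one_smul_alexanderClass (x : D.linkingHom.ker) :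
    (T 1 : ℤ[T;T⁻¹]) • alexanderClass x =
      alexanderClass (MulAut.conjNormal (D.meridian D.baseEdge) x) := by
  change AddMonoidAlgebra.lift ℤ (Module.End ℤ D.AlexanderModule) ℤ
      ((Units.coeHom _).comp (zpowersHom _ D.deckTransformation)) (T 1) _ = _
  rw [T, AddMonoidAlgebra.lift_single]
  simp only [MonoidHom.comp_apply, zpowersHom_apply, toAdd_ofAdd, zpow_one, one_smul]
  rfl

theorem T_smul_alexanderClass (n : ℤ) (x : D.linkingHom.ker) :
    (T n : ℤ[T;T⁻¹]) • alexanderClass x =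
      alexanderClass (MulAut.conjNormal (D.meridian D.baseEdge ^ n) x) := by
  induction n with
  | zero => simp
  | succ n ih =>
    rw [add_comm, T_add, mul_smul, ih, T_one_smul_alexanderClass, zpow_one_add, map_mul,
      MulAut.mul_apply]
  | pred n ih =>
    rw [sub_eq_add_neg, add_comm, T_add, mul_smul, ih, zpow_add, map_mul, MulAut.mul_apply]
    conv_rhs => rw [← T_neg_one_smul_T_one_smul (alexanderClass _), T_one_smul_alexanderClass,
      ← MulAut.mul_apply, ← map_mul]
    simp

/-- The universal derivation of the link group that vanishes on the base meridian. -/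
def alexanderDerivation (g : D.LinkGroup) : D.AlexanderModule :=
  alexanderClass ⟨g * D.meridian D.baseEdge ^ (-(D.linkingHom g).toAdd), by
    rw [MonoidHom.mem_ker, map_mul, map_zpow, linkingHom_meridian, ← ofAdd_zsmul]
    simp⟩

theorem alexanderDerivation_coe (x : D.linkingHom.ker) :
    alexanderDerivation (x : D.LinkGroup) = alexanderClass x := by
  unfold alexanderDerivation
  congr 1
  apply Subtype.ext
  simp [MonoidHom.mem_ker.mp x.2]

/-- With `m` the base meridian and `a`, `b` the linking numbers of `g`, `h`, this is the identity `g
h m^(-a-b) = (g m^(-a)) · m^a (h m^(-b)) m^(-a)`. -/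
theorem alexanderDerivation_mul (g h : D.LinkGroup) :
    alexanderDerivation (g * h) = alexanderDerivation g +
      (T (D.linkingHom g).toAdd : ℤ[T;T⁻¹]) • alexanderDerivation h := by
  unfold alexanderDerivation
  rw [T_smul_alexanderClass, ← alexanderClass_mul]
  congr 1
  apply Subtype.ext
  simp only [Subgroup.coe_mul, MulAut.conjNormal_apply, map_mul, toAdd_mul, neg_add_rev, zpow_add,
    zpow_neg]
  group

theorem alexanderDerivation_one : alexanderDerivation (1 : D.LinkGroup) = 0 :=
  (alexanderDerivation_coe 1).trans alexanderClass_one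

theorem alexanderDerivation_inv (g : D.LinkGroup) :
    alexanderDerivation g⁻¹ =
      -((T (-(D.linkingHom g).toAdd) : ℤ[T;T⁻¹]) • alexanderDerivation g) := by
  have := alexanderDerivation_mul g⁻¹ g
  rw [inv_mul_cancel, alexanderDerivation_one, map_inv, toAdd_inv] at this
  exact eq_neg_of_add_eq_zero_left this.symm

variable (D)

/-- The universal colouring. -/
def universalColor (e : D.Edge) : D.AlexanderModule := alexanderDerivation (D.meridian e)

theorem universalColor_baseEdge : D.universalColor D.baseEdge = 0 := by
  rw [← alexanderClass_one]
  unfold universalColor alexanderDerivation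
  congr 1
  apply Subtype.ext
  simp [linkingHom_meridian]

theorem meridian_over (x : D.Crossing) :
    D.meridian (D.outgoing x .over) = D.meridian (D.incoming x .over) := by
  have := PresentedGroup.one_of_mem (rels := D.wirtingerRelators) ⟨x, Or.inl rfl⟩
  rw [map_mul, map_inv, mul_inv_eq_one] at this
  exact this

theorem meridian_under (x : D.Crossing) :
    D.meridian (D.incoming x .over) ^ (D.sign x : ℤ) * D.meridian (D.outgoing x .under) =
      D.meridian (D.incoming x .under) * D.meridian (D.incoming x .over) ^ (D.sign x : ℤ) := by
  have := PresentedGroup.one_of_mem (rels := D.wirtingerRelators) ⟨x, Or.inr rfl⟩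
  rw [map_mul, map_inv, mul_inv_eq_one, map_mul, map_mul, map_zpow] at this
  exact this

theorem universalColor_add_smul {a b c d : D.Edge}
    (h : D.meridian a * D.meridian b = D.meridian c * D.meridian d) :
    (T 1 : ℤ[T;T⁻¹]) • D.universalColor b + D.universalColor a =
      (T 1 : ℤ[T;T⁻¹]) • D.universalColor d + D.universalColor c := by
  have := congrArg alexanderDerivation h
  simp only [alexanderDerivation_mul, linkingHom_meridian, toAdd_ofAdd] at this
  rw [add_comm, add_comm _ (D.universalColor c)]
  exact this

theorem isColoring_universalColor : D.IsColoring D.universalColor where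
  over_eq x := congrArg alexanderDerivation (D.meridian_over x)
  under_pos x h := D.universalColor_add_smul (by simpa [h] using D.meridian_under x)
  under_neg x h := D.universalColor_add_smul (by
    have := D.meridian_under x
    simp only [h, Units.val_neg, Units.val_one, zpow_neg, zpow_one] at this
    rw [inv_mul_eq_iff_eq_mul, ← mul_assoc, eq_mul_inv_iff_mul_eq] at this
    exact this)

/-- By the product and inverse rules, the elements whose derivation lies in the span form a
subgroup; it contains the meridians, hence everything. -/
theorem span_range_universalColor :
    Submodule.span ℤ[T;T⁻¹] (Set.range D.universalColor) = ⊤ := by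
  refine eq_top_iff.mpr fun x _ => ?_
  obtain ⟨y, rfl⟩ := alexanderClass_surjective x
  rw [← alexanderDerivation_coe]
  have hg : (y : D.LinkGroup) ∈ Subgroup.closure (Set.range D.meridian) := by
    rw [closure_range_meridian]; trivial
  generalize (y : D.LinkGroup) = g at hg ⊢
  induction hg using Subgroup.closure_induction with
  | mem g hg =>
    obtain ⟨e, rfl⟩ := hg
    exact Submodule.subset_span ⟨e, rfl⟩
  | one => rw [alexanderDerivation_one]; exact zero_mem _
  | mul g h _ _ hg hh =>
    rw [alexanderDerivation_mul]
    exact add_mem hg (Submodule.smul_mem _ _ hh)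
  | inv g _ hg =>
    rw [alexanderDerivation_inv]
    exact neg_mem (Submodule.smul_mem _ _ hg)

variable {D}

/-- The universal property of the universal colouring. -/
theorem IsColoring.exists_linearMap {N : Type*} [AddCommGroup N] [Module ℤ[T;T⁻¹] N]
    {c : D.Edge → N} (hc : D.IsColoring c) (hb : c D.baseEdge = 0) :
    ∃ f : D.AlexanderModule →ₗ[ℤ[T;T⁻¹]] N, ∀ e, f (D.universalColor e) = c e := by
  let f : D.AlexanderModule →+ N := MonoidHom.toAdditiveLeft (Abelianization.lift hc.kerHom)
  have hf : ∀ x, f (alexanderClass x) = hc.affineHom x 0 := fun x => rfl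
  -- As the base colour is `0`, the base meridian acts as multiplication by `t` and fixes `0`; the
  -- correcting power of it in `alexanderDerivation` therefore has no effect.
  have hbase : hc.affineHom (D.meridian D.baseEdge)⁻¹ 0 = 0 := by
    rw [map_inv, Equiv.Perm.inv_eq_iff_eq, hc.affineHom_meridian, affinePerm_apply, hb]
    simp
  refine ⟨laurentLinearMap f fun x => ?_, fun e => ?_⟩
  · obtain ⟨y, rfl⟩ := alexanderClass_surjective x
    rw [T_one_smul_alexanderClass, hf, hf, MulAut.conjNormal_apply, map_mul, map_mul,
      Equiv.Perm.mul_apply, hbase, Equiv.Perm.mul_apply, hc.affineHom_meridian, affinePerm_apply,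
      hb, add_zero]
  · change f (D.universalColor e) = c e
    rw [universalColor, alexanderDerivation, hf]
    simp only [linkingHom_meridian, toAdd_ofAdd, zpow_neg, zpow_one]
    rw [map_mul, Equiv.Perm.mul_apply, hbase, hc.affineHom_meridian, affinePerm_apply]
    simp

/-- In each relation the coefficients have the same sum on both sides. This allows the colour of the
base edge to be normalized to `0`. -/
theorem IsColoring.sub_const {N : Type*} [AddCommGroup N] [Module ℤ[T;T⁻¹] N]
    {c : D.Edge → N} (hc : D.IsColoring c) (a : N) : D.IsColoring fun e => c e - a where
  over_eq x := by rw [hc.over_eq]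
  under_pos x h := by
    simp only [smul_sub, sub_add_sub_comm, hc.under_pos x h]
  under_neg x h := by
    simp only [smul_sub, sub_add_sub_comm, hc.under_neg x h]

end LinkDiagram

/-! ### The Alexander module of a pretzel knot with three odd columns -/

namespace Pretzel

open LaurentPolynomial LinkDiagram

/-- In a coloured column whose colours at the top are `a` and `a + d`, the difference of the colours
at height `h` is this multiple of `d`. -/
def diffCoeff (h : ℕ) : ℤ[T;T⁻¹] := if h.bodd then -T 1 else 1

/-- In a coloured column whose colours at the top are `a` and `a + d`, the colour on the left at
height `h` is the sum of `a` and this multiple of `d`. -/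
def leftCoeff (pos : Prop) [Decidable pos] : ℕ → ℤ[T;T⁻¹]
  | 0 => 0
  | h + 1 => leftCoeff pos h + if pos then diffCoeff h else -diffCoeff (h + 1)

/-- The same for the colour on the given side. -/
def sideCoeff (pos : Prop) [Decidable pos] (h : ℕ) (side : Bool) : ℤ[T;T⁻¹] :=
  leftCoeff pos h + if side then diffCoeff h else 0

theorem leftCoeff_two_mul (pos : Prop) [Decidable pos] (m : ℕ) :
    leftCoeff pos (2 * m) = (if pos then (m : ℤ[T;T⁻¹]) else -m) * (1 - T 1) := by
  induction m with
  | zero => simp [leftCoeff]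
  | succ m ih =>
    rw [Nat.mul_succ, leftCoeff, leftCoeff, ih]
    split_ifs <;> simp [diffCoeff] <;> ring

theorem exists_natAbs_eq (q : ℤ) : ∃ m : ℕ, (2 * q + 1).natAbs = 2 * m + 1 ∧
    (0 < 2 * q + 1 ∧ q = m ∨ ¬ 0 < 2 * q + 1 ∧ q = -m - 1) := by
  rcases le_or_gt 0 q with h | h
  · exact ⟨q.toNat, by omega, by omega⟩
  · exact ⟨(-q - 1).toNat, by omega, by omega⟩

/-- Each pair of crossings contributes `±(1 - t)`, and one crossing is left over. The point is that
a single formula in `q` serves both signs of the parameter. -/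
theorem sideCoeff_bottom (q : ℤ) (side : Bool) :
    sideCoeff (0 < 2 * q + 1) (2 * q + 1).natAbs side =
      if side then ((q : ℤ[T;T⁻¹]) + 1) * (1 - T 1) else 1 + (q : ℤ[T;T⁻¹]) * (1 - T 1) := by
  obtain ⟨m, hm, ⟨hq, rfl⟩ | ⟨hq, hq'⟩⟩ := exists_natAbs_eq q
  · rw [hm, sideCoeff, leftCoeff, leftCoeff_two_mul]
    cases side <;> simp [hq, diffCoeff] <;> ring
  · rw [hm, sideCoeff, leftCoeff, leftCoeff_two_mul]
    have : (q : ℤ[T;T⁻¹]) = -m - 1 := by rw [hq']; push_cast; rfl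
    rw [this]
    cases side <;> simp [hq, diffCoeff] <;> ring

/-! ### Colourings of the columns and of the arcs -/

section Coloring

variable {N : Type*} [AddCommGroup N] [Module ℤ[T;T⁻¹] N]

/-- The relation between the colours at the top and at the bottom of a crossing of a column. -/
def CrossingRelation (pos : Prop) [Decidable pos] (odd : Bool) (l r l' r' : N) : Prop :=
  (if pos then l' = r else r' = l) ∧
    if odd then (T 1 : ℤ[T;T⁻¹]) • (r' - l') = l - r else r' - l' = (T 1 : ℤ[T;T⁻¹]) • (l - r)

/-- Handedness and parity of the height decide which strand is over and which way it runs. In each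
of the four cases the over-strand gives the first half of `CrossingRelation`, and the under-strand
relation, corrected by it, gives the second. -/
theorem isColoring_iff {p : Fin 3 → ℤ} {hp : ∀ j, Odd (p j)} {c : Edge p → N} :
    (pretzelKnot p hp).IsColoring c ↔ ∀ j h, h < (p j).natAbs →
      CrossingRelation (0 < p j) h.bodd (c (edgeAt p j h false)) (c (edgeAt p j h true))
        (c (edgeAt p j (h + 1) false)) (c (edgeAt p j (h + 1) true)) := by
  constructor
  · intro H j h hh
    let x : Crossing p := ⟨j, ⟨h, hh⟩⟩
    have h1 : c (outgoing p x .over) = c (incoming p x .over) := H.over_eq x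
    have h2 : (if 0 < p j then -1 else 1 : ℤˣ) = 1 →
      (T 1 : ℤ[T;T⁻¹]) • c (outgoing p x .under) + c (incoming p x .over) =
      (T 1 : ℤ[T;T⁻¹]) • c (incoming p x .over) + c (incoming p x .under) := H.under_pos x
    have h3 : (if 0 < p j then -1 else 1 : ℤˣ) = -1 →
      (T 1 : ℤ[T;T⁻¹]) • c (incoming p x .over) + c (outgoing p x .under) =
      (T 1 : ℤ[T;T⁻¹]) • c (incoming p x .under) + c (incoming p x .over) := H.under_neg x
    unfold CrossingRelation
    by_cases hpos : 0 < p j <;> cases hb : h.bodd <;>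
      simp [outgoing, incoming, isDown, x, hpos, hb] at h1 h2 h3 ⊢
    · exact ⟨h1.symm, by linear_combination (norm := module) h3 + (T 1 : ℤ[T;T⁻¹]) • h1⟩
    · exact ⟨h1, by linear_combination (norm := module) -h3 - (T 1 : ℤ[T;T⁻¹]) • h1⟩
    · exact ⟨h1, by linear_combination (norm := module) h2 + h1⟩
    · exact ⟨h1.symm, by linear_combination (norm := module) -h2 - h1⟩
  · intro H
    refine ⟨?_, ?_, ?_⟩
    all_goals
      rintro ⟨j, h, hh⟩
      have := H j h hh
      unfold CrossingRelation at this
    · change c (outgoing p ⟨j, h, hh⟩ .over) = c (incoming p ⟨j, h, hh⟩ .over)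
      by_cases hpos : 0 < p j <;> cases hb : h.bodd <;>
        simp [outgoing, incoming, isDown, hpos, hb] at this ⊢
      all_goals first | exact this.1 | exact this.1.symm
    · change (if 0 < p j then -1 else 1 : ℤˣ) = 1 →
        (T 1 : ℤ[T;T⁻¹]) • c (outgoing p ⟨j, h, hh⟩ .under) + c (incoming p ⟨j, h, hh⟩ .over) =
        (T 1 : ℤ[T;T⁻¹]) • c (incoming p ⟨j, h, hh⟩ .over) + c (incoming p ⟨j, h, hh⟩ .under)
      by_cases hpos : 0 < p j <;> cases hb : h.bodd <;>
        simp [outgoing, incoming, isDown, hpos, hb] at this ⊢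
      · linear_combination (norm := module) this.2 - this.1
      · linear_combination (norm := module) this.1 - this.2
    · change (if 0 < p j then -1 else 1 : ℤˣ) = -1 →
        (T 1 : ℤ[T;T⁻¹]) • c (incoming p ⟨j, h, hh⟩ .over) + c (outgoing p ⟨j, h, hh⟩ .under) =
        (T 1 : ℤ[T;T⁻¹]) • c (incoming p ⟨j, h, hh⟩ .under) + c (incoming p ⟨j, h, hh⟩ .over)
      by_cases hpos : 0 < p j <;> cases hb : h.bodd <;>
        simp [outgoing, incoming, isDown, hpos, hb] at this ⊢
      · linear_combination (norm := module) this.2 + (T 1 : ℤ[T;T⁻¹]) • this.1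
      · linear_combination (norm := module) -this.2 - (T 1 : ℤ[T;T⁻¹]) • this.1

theorem crossingRelation_sideCoeff (pos : Prop) [Decidable pos] (h : ℕ) (a d : N) :
    CrossingRelation pos h.bodd (a + sideCoeff pos h false • d) (a + sideCoeff pos h true • d)
      (a + sideCoeff pos (h + 1) false • d) (a + sideCoeff pos (h + 1) true • d) := by
  unfold CrossingRelation
  by_cases hpos : pos <;> cases hb : h.bodd <;>
    simp [sideCoeff, leftCoeff, diffCoeff, hb, hpos] <;> module

theorem CrossingRelation.unique {pos : Prop} [Decidable pos] {odd : Bool} {l r l₁ r₁ l₂ r₂ : N}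
    (h₁ : CrossingRelation pos odd l r l₁ r₁) (h₂ : CrossingRelation pos odd l r l₂ r₂) :
    l₁ = l₂ ∧ r₁ = r₂ := by
  have hd : r₁ - l₁ = r₂ - l₂ := by
    cases odd
    · exact h₁.2.trans h₂.2.symm
    · have h : (T 1 : ℤ[T;T⁻¹]) • (r₁ - l₁) = (T 1 : ℤ[T;T⁻¹]) • (r₂ - l₂) :=
        h₁.2.trans h₂.2.symm
      rw [← T_neg_one_smul_T_one_smul (r₁ - l₁), h, T_neg_one_smul_T_one_smul]
  have h1 := h₁.1
  have h2 := h₂.1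
  split_ifs at h1 h2
  · subst h1 h2
    exact ⟨rfl, sub_left_injective hd⟩
  · subst h1 h2
    exact ⟨sub_right_injective hd, rfl⟩

variable {p : Fin 3 → ℤ} {hp : ∀ j, Odd (p j)}

theorem natAbs_ne_zero_of_odd {n : ℤ} (hn : Odd n) : n.natAbs ≠ 0 := fun h => by
  rw [Int.natAbs_eq_zero.mp h] at hn
  simp at hn

/-- The colours of the edges that pass through a column are determined by those at the top. -/
theorem color_edgeAt {c : Edge p → N} (hc : (pretzelKnot p hp).IsColoring c) (j : Fin 3) (h : ℕ)
    (hh : h ≤ (p j).natAbs) (side : Bool) :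
    c (edgeAt p j h side) = c (.inl (j - 1)) +
      sideCoeff (0 < p j) h side • (c (.inl j) - c (.inl (j - 1))) := by
  induction h generalizing side with
  | zero => cases side <;> simp [edgeAt, sideCoeff, leftCoeff, diffCoeff]
  | succ h ih =>
    have h1 := isColoring_iff.mp hc j h hh
    rw [ih (by omega), ih (by omega)] at h1
    have h2 := h1.unique (crossingRelation_sideCoeff (0 < p j) h _ _)
    cases side
    · exact h2.1
    · exact h2.2

theorem edgeAt_bottom (hp : ∀ j, Odd (p j)) (j : Fin 3) (side : Bool) :
    edgeAt p j (p j).natAbs side = .inr (.inl (if side then j else j - 1)) := by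
  simp [edgeAt, natAbs_ne_zero_of_odd (hp j)]

/-- The colours of the arcs at the top of a coloured pretzel diagram satisfy these relations, which
say that the two ways of computing the colours of the arcs at the bottom give the same result. -/
def ArcRelation (q : Fin 3 → ℤ) (a : Fin 3 → N) (j : Fin 3) : Prop :=
  a (j - 1) + (((q j : ℤ[T;T⁻¹]) + 1) * (1 - T 1)) • (a j - a (j - 1)) =
    a j + (1 + (q (j + 1) : ℤ[T;T⁻¹]) * (1 - T 1)) • (a (j + 1) - a j)

variable {q : Fin 3 → ℤ}

theorem arcRelation_of_isColoring (hq : ∀ j, p j = 2 * q j + 1) {c : Edge p → N}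
    (hc : (pretzelKnot p hp).IsColoring c) (j : Fin 3) :
    ArcRelation q (fun j => c (.inl j)) j := by
  have h1 := color_edgeAt hc j _ le_rfl true
  have h2 := color_edgeAt hc (j + 1) _ le_rfl false
  have hs : ∀ j side, sideCoeff (0 < p j) (p j).natAbs side =
      sideCoeff (0 < 2 * q j + 1) (2 * q j + 1).natAbs side := fun j side => by simp only [hq]
  rw [edgeAt_bottom hp, hs, sideCoeff_bottom] at h1 h2
  simp only [if_true, Bool.false_eq_true, if_false, add_sub_cancel_right] at h1 h2
  unfold ArcRelation
  rw [← h1, ← h2]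

/-- The colouring of a pretzel diagram with given colours of the arcs at the top. -/
def arcColoring (p q : Fin 3 → ℤ) (a : Fin 3 → N) : Edge p → N
  | .inl j => a j
  | .inr (.inl j) => a (j - 1) + (((q j : ℤ[T;T⁻¹]) + 1) * (1 - T 1)) • (a j - a (j - 1))
  | .inr (.inr ⟨j, h, side⟩) =>
    a (j - 1) + sideCoeff (0 < p j) (h + 1) side • (a j - a (j - 1))

theorem arcColoring_edgeAt (hp : ∀ j, Odd (p j)) (hq : ∀ j, p j = 2 * q j + 1) {a : Fin 3 → N}
    (ha : ∀ j, ArcRelation q a j) (j : Fin 3) (h : ℕ) (hh : h ≤ (p j).natAbs) (side : Bool) :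
    arcColoring p q a (edgeAt p j h side) =
      a (j - 1) + sideCoeff (0 < p j) h side • (a j - a (j - 1)) := by
  rcases h with _ | h
  · cases side <;> simp [edgeAt, sideCoeff, leftCoeff, diffCoeff, arcColoring]
  · rcases hh.eq_or_lt with hh | hh
    · have hs : sideCoeff (0 < p j) (h + 1) side =
          sideCoeff (0 < 2 * q j + 1) (2 * q j + 1).natAbs side := by rw [hh]; simp only [hq]
      rw [hs, sideCoeff_bottom, hh, edgeAt_bottom hp]
      cases side
      -- The bottom arc `j - 1` was coloured from column `j - 1`; the arc relation says that column
      -- `j` gives the same colour.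
      · have := ha (j - 1)
        unfold ArcRelation at this
        rw [sub_add_cancel] at this
        exact this
      · rfl
    · have : h < (p j).natAbs - 1 := by omega
      simp [edgeAt, this, arcColoring]

theorem isColoring_arcColoring (hq : ∀ j, p j = 2 * q j + 1) {a : Fin 3 → N}
    (ha : ∀ j, ArcRelation q a j) : (pretzelKnot p hp).IsColoring (arcColoring p q a) := by
  refine isColoring_iff.mpr fun j h hh => ?_
  rw [arcColoring_edgeAt hp hq ha j h hh.le, arcColoring_edgeAt hp hq ha j h hh.le,
    arcColoring_edgeAt hp hq ha j (h + 1) hh, arcColoring_edgeAt hp hq ha j (h + 1) hh]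
  exact crossingRelation_sideCoeff _ _ _ _

theorem exists_edgeAt_eq (hp : ∀ j, Odd (p j)) (e : Edge p) :
    ∃ j h side, h ≤ (p j).natAbs ∧ e = edgeAt p j h side := by
  rcases e with j | j | ⟨j, h, side⟩
  · exact ⟨j, 0, true, Nat.zero_le _, by simp [edgeAt]⟩
  · exact ⟨j, _, true, le_rfl, by simp [edgeAt_bottom hp]⟩
  · exact ⟨j, h + 1, side, by omega, by simp [edgeAt]⟩

end Coloring

/-- The presentation matrix of the Alexander module of the pretzel knot with the parameters
`2 q₀ + 1`, `2 q₁ + 1`, `2 q₂ + 1`. -/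
def alexanderMatrix (q : Fin 3 → ℤ) : Matrix (Fin 2) (Fin 2) ℤ[T;T⁻¹] :=
  let t : ℤ[T;T⁻¹] := T 1
  !![(1 + (q 0 : ℤ[T;T⁻¹]) + q 1) * (1 - t), (q 0 : ℤ[T;T⁻¹]) - (q 0 + 1) * t;
    (q 1 : ℤ[T;T⁻¹]) - (q 1 + 1) * t, -(1 + (q 2 : ℤ[T;T⁻¹]) - q 2 * t)]

theorem isPresentationMatrix_alexanderMatrix {p q : Fin 3 → ℤ} (hp : ∀ j, Odd (p j))
    (hq : ∀ j, p j = 2 * q j + 1) :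
    IsPresentationMatrix (alexanderMatrix q) (pretzelKnot p hp).AlexanderModule := by
  set D := pretzelKnot p hp with hD
  let u : Edge p → D.AlexanderModule := D.universalColor
  have hu : D.IsColoring u := D.isColoring_universalColor
  let x : Fin 2 → D.AlexanderModule := ![u (.inl 1) - u (.inl 0), u (.inl 2) - u (.inl 1)]
  let π := Fintype.linearCombination ℤ[T;T⁻¹] x
  have hπ : ∀ v, π v = v 0 • (u (.inl 1) - u (.inl 0)) + v 1 • (u (.inl 2) - u (.inl 1)) := by
    intro v
    simp [π, x, Fintype.linearCombination_apply, Fin.sum_univ_two]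
  have hrel := arcRelation_of_isColoring hq hu
  refine ⟨π, ?_, le_antisymm ?_ ?_⟩
  · have harc : ∀ j, u (.inl j) - u (.inl 0) ∈ LinearMap.range π := by
      intro j
      fin_cases j
      · simp
      · exact ⟨![1, 0], by simp [hπ]⟩
      · exact ⟨![1, 1], by simp [hπ]⟩
    have hedge : ∀ e, u e - u (.inl 0) ∈ LinearMap.range π := by
      intro e
      obtain ⟨j, h, side, hh, rfl⟩ := exists_edgeAt_eq hp e
      rw [color_edgeAt hu j h hh side, ← sub_sub_sub_cancel_right (u (.inl j)) _ (u (.inl 0)),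
        add_sub_right_comm]
      exact add_mem (harc _) (Submodule.smul_mem _ _ (sub_mem (harc _) (harc _)))
    -- Differences of colours suffice because the base edge has colour `0`.
    have h0 : u (.inl 0) ∈ LinearMap.range π := by
      have := hedge D.baseEdge
      rw [show u D.baseEdge = 0 from D.universalColor_baseEdge, zero_sub] at this
      simpa using neg_mem this
    rw [← LinearMap.range_eq_top, eq_top_iff, ← D.span_range_universalColor, Submodule.span_le]
    rintro _ ⟨e, rfl⟩
    simpa using add_mem (hedge e) h0
  -- No further relations: the module presented by the matrix itself colours the diagram, so the
  -- universal property yields `f` with `f ∘ π` the quotient map, and the kernel of `π` lies in `S`.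
  · let S := Submodule.span ℤ[T;T⁻¹] (Set.range fun i => alexanderMatrix q i)
    let y : Fin 2 → (Fin 2 → ℤ[T;T⁻¹]) ⧸ S := fun i => S.mkQ (Pi.single i 1)
    have hy : ∀ v, S.mkQ v = v 0 • y 0 + v 1 • y 1 := by
      intro v
      rw [← sum_smul_map_single S.mkQ v, Fin.sum_univ_two]
    have hrow : ∀ i, alexanderMatrix q i 0 • y 0 + alexanderMatrix q i 1 • y 1 = 0 := by
      intro i
      rw [← hy, Submodule.mkQ_apply, Submodule.Quotient.mk_eq_zero]
      exact Submodule.subset_span ⟨i, rfl⟩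
    have h0 := hrow 0
    have h1 := hrow 1
    simp only [alexanderMatrix, Matrix.of_apply, Matrix.cons_val_zero, Matrix.cons_val_one] at h0 h1
    let a : Fin 3 → (Fin 2 → ℤ[T;T⁻¹]) ⧸ S := ![0, y 0, y 0 + y 1]
    have ha : ∀ j, ArcRelation q a j := by
      intro j
      fin_cases j
      · change y 0 + y 1 + (((q 0 : ℤ[T;T⁻¹]) + 1) * (1 - T 1)) • (0 - (y 0 + y 1)) =
          0 + (1 + (q 1 : ℤ[T;T⁻¹]) * (1 - T 1)) • (y 0 - 0)
        linear_combination (norm := module) -h0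
      · change 0 + (((q 1 : ℤ[T;T⁻¹]) + 1) * (1 - T 1)) • (y 0 - 0) =
          y 0 + (1 + (q 2 : ℤ[T;T⁻¹]) * (1 - T 1)) • (y 0 + y 1 - y 0)
        linear_combination (norm := module) h1
      · change y 0 + (((q 2 : ℤ[T;T⁻¹]) + 1) * (1 - T 1)) • (y 0 + y 1 - y 0) =
          y 0 + y 1 + (1 + (q 0 : ℤ[T;T⁻¹]) * (1 - T 1)) • (0 - (y 0 + y 1))
        linear_combination (norm := module) h0 - h1
    obtain ⟨f, hf⟩ := ((isColoring_arcColoring (hp := hp) hq ha).sub_const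
      (arcColoring p q a D.baseEdge)).exists_linearMap (sub_self _)
    have hfu : ∀ i j, f (u (.inl i) - u (.inl j)) = a i - a j := by
      intro i j
      have hi := hf (.inl i)
      have hj := hf (.inl j)
      rw [map_sub]
      change f (u (.inl i)) = a i - _ at hi
      change f (u (.inl j)) = a j - _ at hj
      rw [hi, hj, sub_sub_sub_cancel_right]
    intro v hv
    have : f (π v) = S.mkQ v := by
      rw [hπ, map_add, map_smul, map_smul, hfu, hfu, hy]
      simp [a]
    rw [LinearMap.mem_ker.mp hv, map_zero] at this
    exact (Submodule.Quotient.mk_eq_zero S).mp this.symm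
  · rw [Submodule.span_le]
    rintro _ ⟨i, rfl⟩
    rw [SetLike.mem_coe, LinearMap.mem_ker, hπ]
    have h0 : u (.inl 2) + (((q 0 : ℤ[T;T⁻¹]) + 1) * (1 - T 1)) • (u (.inl 0) - u (.inl 2)) =
      u (.inl 0) + (1 + (q 1 : ℤ[T;T⁻¹]) * (1 - T 1)) • (u (.inl 1) - u (.inl 0)) := hrel 0
    have h1 : u (.inl 0) + (((q 1 : ℤ[T;T⁻¹]) + 1) * (1 - T 1)) • (u (.inl 1) - u (.inl 0)) =
      u (.inl 1) + (1 + (q 2 : ℤ[T;T⁻¹]) * (1 - T 1)) • (u (.inl 2) - u (.inl 1)) := hrel 1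
    fin_cases i
    · simp [alexanderMatrix]
      linear_combination (norm := module) -h0
    · simp [alexanderMatrix]
      linear_combination (norm := module) h1

/-! ### The elementary ideals of the family -/

theorem elementaryIdeal_pretzelFamily (s i : ℤ) (r : ℕ) :
    (pretzelFamily s i).elementaryIdeal r =
      minorIdeal (alexanderMatrix ![-s - 1, s, i]) (2 + 1 - r) := by
  refine elementaryIdeal_eq_minorIdeal (isPresentationMatrix_alexanderMatrix _ fun j => ?_) r
  fin_cases j
  · simp; ring
  · rfl
  · rfl

theorem det_alexanderMatrix_family (s i : ℤ) :
    (alexanderMatrix ![-s - 1, s, i]).det =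
      C (s * (s + 1)) * T 2 - C (2 * s * (s + 1) + 1) * T 1 + C (s * (s + 1)) := by
  have hT : (T 2 : ℤ[T;T⁻¹]) = T 1 * T 1 := by rw [← T_add]; rfl
  rw [Matrix.det_fin_two, hT]
  simp [alexanderMatrix]
  ring

theorem minorIdeal_one_alexanderMatrix_family_le (s k k' : ℤ) :
    minorIdeal (alexanderMatrix ![-s - 1, s, (2 * k - 1) * s + k - 1]) 1 ≤
      minorIdeal (alexanderMatrix ![-s - 1, s, (2 * k' - 1) * s + k' - 1]) 1 := by
  set B := alexanderMatrix ![-s - 1, s, (2 * k' - 1) * s + k' - 1] with hB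
  have h1 : -(s : ℤ[T;T⁻¹]) - 1 + (s : ℤ[T;T⁻¹]) * T 1 ∈ minorIdeal B 1 := by
    simpa [hB, alexanderMatrix] using apply_mem_minorIdeal_one B 0 1
  have h2 : (s : ℤ[T;T⁻¹]) - ((s : ℤ[T;T⁻¹]) + 1) * T 1 ∈ minorIdeal B 1 := by
    simpa [hB, alexanderMatrix] using apply_mem_minorIdeal_one B 1 0
  refine minorIdeal_one_le fun i j => ?_
  fin_cases i <;> fin_cases j
  · simp [alexanderMatrix]
  · simpa [alexanderMatrix] using h1
  · simpa [alexanderMatrix] using h2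
  · have h3 : ∀ a b : ℤ[T;T⁻¹], a * (-(s : ℤ[T;T⁻¹]) - 1 + (s : ℤ[T;T⁻¹]) * T 1) +
        b * ((s : ℤ[T;T⁻¹]) - ((s : ℤ[T;T⁻¹]) + 1) * T 1) ∈ minorIdeal B 1 := fun a b =>
      add_mem (Ideal.mul_mem_left _ _ h1) (Ideal.mul_mem_left _ _ h2)
    convert h3 (-((2 * k - 1) * s + k - 1) + (2 * k - 1) * (s + 1))
      (-((2 * k - 1) * s + k - 1) - (2 * k - 1) + (2 * k - 1) * (s + 1)) using 1
    simp [alexanderMatrix]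
    ring

end Pretzel

end

open LaurentPolynomial in
theorem theorem4p1 (s : ℤ) (hs : 0 < s) :
    (∀ i : ℤ, s < i →
      (pretzelFamily s i).IsAlexanderPolynomial
        (C (s * (s + 1)) * T 2 - C (2 * s * (s + 1) + 1) * T 1 + C (s * (s + 1)))) ∧
    (∀ k k' : ℤ, 0 < k → 0 < k' → ∀ r : ℕ,
      (pretzelFamily s ((2 * k - 1) * s + k - 1)).elementaryIdeal r =
        (pretzelFamily s ((2 * k' - 1) * s + k' - 1)).elementaryIdeal r) := by
  constructor
  · intro i _
    have h : (pretzelFamily s i).elementaryIdeal 1 = Ideal.span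
        {C (s * (s + 1)) * T 2 - C (2 * s * (s + 1) + 1) * T 1 + C (s * (s + 1))} := by
      rw [Pretzel.elementaryIdeal_pretzelFamily, ← Pretzel.det_alexanderMatrix_family s i]
      exact minorIdeal_self _
    exact ⟨⟨⟨_, rfl⟩, h.le⟩, fun I hI => h ▸ hI.2⟩
  · intro k k' _ _ r
    rw [Pretzel.elementaryIdeal_pretzelFamily, Pretzel.elementaryIdeal_pretzelFamily]
    rcases r with _ | _ | _ | r
    · rw [minorIdeal_eq_bot _ (by simp), minorIdeal_eq_bot _ (by simp)]
    · change minorIdeal _ 2 = minorIdeal _ 2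
      rw [minorIdeal_self, minorIdeal_self, Pretzel.det_alexanderMatrix_family,
        Pretzel.det_alexanderMatrix_family]
    · exact le_antisymm (Pretzel.minorIdeal_one_alexanderMatrix_family_le s k k')
        (Pretzel.minorIdeal_one_alexanderMatrix_family_le s k' k)
    · have : 2 + 1 - (r + 1 + 1 + 1) = 0 := by omega
      rw [this, minorIdeal_zero, minorIdeal_zero]
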